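/- Let $(\mathcal X,d)$ be a separable metric space with its Borel $\sigma$-algebra, let $\mu$ be an atomless Borel probability measure on $\mathcal X$, and let $l:\mathcal X\to\{-1,1\}$ be a measurable labeling function that is countably piecewise continuous, i.e. $\mathcal X$ is covered by countably many sets (pieces) whose topological boundaries are $\mu$-null and $l$ is continuous on the interior of each piece. Let $x_1,x_2,\dots$ be i.i.d. with law $\mu$ and, for each $n$, let $S=S_n=\{(x_1,l(x_1)),\dots,(x_n,l(x_n))\}$. For a subset $\tilde S\subset S$ let $w=w_{\tilde S}$ be the weight function with $w(\tilde x)=\min\{d(\tilde x,x_j): j\le n,\ l(x_j)\neq l(\tilde x)\}$ for the points $\tilde x$ of $\tilde S$ (the nearest-enemy distance; it is set to $1$ if all points of $S$ have the same label), and $w(x)=1$ for all points $x$ not in $\tilde S$. Let $$h_{\tilde S}(x)=l\Big(\operatorname*{arg\,min}_{y\in\tilde S}\frac{d(y,x)}{w(y)\,w(x)}\Big),\qquad x\in\mathcal X,$$ where ties are broken by an arbitrary fixed rule which selects one of the tied sample points as a measurable function of these points and of the query $x$ (the rule may depend on $n$ and on the indices of the tied points). Call $\tilde S$ consistent if $h_{\tilde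 S}(x_j)=l(x_j)$ for all $j\le n$. Then, almost surely, for every choice of consistent subsets $S_n^*\subset S_n$ of minimal cardinality, $n\ge 1$, $$\operatorname{err}(h_{S_n^*})=\mu\{x\in\mathcal X: h_{S_n^*}(x)\ne l(x)\}\xrightarrow[n\to\infty]{}0 .$$ -/

import Mathlib

open MeasureTheory ProbabilityTheory Filter Topology

noncomputable section

namespace WNN

open scoped Classical in
/-- Nearest-enemy distance of `q` in the sample `x`: the distance from `q` to the closest sample
point whose label differs from that of `q`. If the sample has no such point (the minimum over the
empty set), the default weight `1` is used. -/
def enemyDist {X : Type*} [MetricSpace X] (l : X → ℤ) {n : ℕ} (x : Fin n → X) (q : X) : ℝ :=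
  if h : (Finset.univ.filter fun j => l (x j) ≠ l q).Nonempty then
    (Finset.univ.filter fun j => l (x j) ≠ l q).inf' h fun j => dist q (x j)
  else 1

open scoped Classical in
/-- The weight function attached to the subsample with index set `I`: the nearest-enemy distance
(in the full sample) on the points of the subsample, and `1` at every other point. -/
def enemyWeight {X : Type*} [MetricSpace X] (l : X → ℤ) {n : ℕ} (x : Fin n → X)
    (I : Finset (Fin n)) (q : X) : ℝ :=
  if ∃ i ∈ I, x i = q then enemyDist l x q else 1

/-- The weighted distance `d(a, b) / (w(a) w(b))`. -/
def weightedDist {X : Type*} [MetricSpace X] (w : X → ℝ) (a b : X) : ℝ :=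
  dist a b / (w a * w b)

open scoped Classical in
/-- The indices in `I` whose sample points are at minimal weighted distance from `q`. -/
def nearest {X : Type*} [MetricSpace X] (w : X → ℝ) {n : ℕ} (x : Fin n → X)
    (I : Finset (Fin n)) (q : X) : Finset (Fin n) :=
  I.filter fun i => ∀ j ∈ I, weightedDist w (x i) q ≤ weightedDist w (x j) q

/-- A measurable tie-breaking rule: it selects one element of a nonempty set `T` of tied sample
indices, as a measurable function of the tied sample points and of the query point. -/
structure TieBreak (X : Type*) [MeasurableSpace X] where
  pick : ∀ {n : ℕ} (T : Finset (Fin n)), T.Nonempty → (T → X) → X → T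
  measurable_pick : ∀ {n : ℕ} (T : Finset (Fin n)) (hT : T.Nonempty),
    Measurable fun p : (T → X) × X => pick T hT p.1 p.2

/-- Ties decided in favour of the smallest index. -/
instance {X : Type*} [MeasurableSpace X] : Inhabited (TieBreak X) :=
  ⟨{ pick := fun T hT _ _ => ⟨T.min' hT, T.min'_mem hT⟩
     measurable_pick := fun _ _ => measurable_const }⟩

open scoped Classical in
/-- The weighted nearest neighbor classifier of the subsample with index set `I` under the weight
function `w`: the label of a weighted nearest neighbor of `q` in the subsample. On the empty
subsample the value is `0`, which is not a label. -/
def classifier {X : Type*} [MetricSpace X] [MeasurableSpace X] (τ : TieBreak X) (l : X → ℤ)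
    (w : X → ℝ) {n : ℕ} (x : Fin n → X) (I : Finset (Fin n)) (q : X) : ℤ :=
  if h : (nearest w x I q).Nonempty then
    l (x (τ.pick (nearest w x I q) h (fun i => x i) q))
  else 0

/-- The classifier with nearest-enemy weights. -/
def enemyClassifier {X : Type*} [MetricSpace X] [MeasurableSpace X] (τ : TieBreak X) (l : X → ℤ)
    {n : ℕ} (x : Fin n → X) (I : Finset (Fin n)) (q : X) : ℤ :=
  classifier τ l (enemyWeight l x I) x I q

/-- The classifier of the subsample `I` labels every sample point correctly. -/
def IsConsistent {X : Type*} [MetricSpace X] [MeasurableSpace X] (τ : TieBreak X) (l : X → ℤ)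
    {n : ℕ} (x : Fin n → X) (I : Finset (Fin n)) : Prop :=
  ∀ j, enemyClassifier τ l x I (x j) = l (x j)

/-- `I` is a consistent subsample of minimal cardinality. -/
def IsMinConsistent {X : Type*} [MetricSpace X] [MeasurableSpace X] (τ : TieBreak X) (l : X → ℤ)
    {n : ℕ} (x : Fin n → X) (I : Finset (Fin n)) : Prop :=
  IsConsistent τ l x I ∧ ∀ J : Finset (Fin n), IsConsistent τ l x J → I.card ≤ J.card

/-- The misclassification probability of `h` when the point has law `μ` and true label `l`. -/
def err {X : Type*} [MeasurableSpace X] (μ : Measure X) (l h : X → ℤ) : ENNReal :=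
  μ {q | h q ≠ l q}

/-- `l` is countably piecewise continuous (with respect to `μ`): the space is covered by countably
many pieces with `μ`-null boundary, and `l` is continuous on the interior of each piece. -/
def CountablyPiecewiseContinuous {X : Type*} [TopologicalSpace X] [MeasurableSpace X]
    (μ : Measure X) (l : X → ℤ) : Prop :=
  ∃ A : ℕ → Set X, (⋃ i, A i) = Set.univ ∧
    ∀ i, μ (frontier (A i)) = 0 ∧ ContinuousOn l (interior (A i))

end WNN

end

/-!
The proof is a sample compression argument.

*Small consistent subsamples exist.* Almost every point has a neighbourhood on which `l` is
constant, so up to a set of small measure the space is covered by finitely many small balls (cells)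
in which any two points are closer to each other than to points of the opposite label. Keep one
sample point in each of these cells and all sample points outside of them. Every sample point then
lies within the nearest-enemy distance of a kept point of its own label, hence at weighted distance
less than `1`, whereas enemies are at weighted distance at least `1`; so the kept points are
consistent (`isConsistent_of_cover`). By the strong law of large numbers their number is `o(n)`,
and a consistent subsample of minimal cardinality is no larger
(`ae_eventually_exists_isConsistent`).

*Small consistent subsamples generalize.* The weight of the query scales all weighted distances
alike, so the classifier of a subsample `I` depends only on `I` and on the weights of its points.
These are determined by `I` together with one nearest enemy of each of its points, a set `K` of at
most `2 * #I` sample points (`exists_enemyClassifier_eq_localClassifier`). For fixed `I ⊆ K` the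
remaining sample points are independent of the classifier, so it labels all of them correctly in
spite of an error larger than `ε` with probability at most `(1 - ε) ^ (n - #K)`
(`pi_err_gt_and_correct_le`). Summed over all pairs `I ⊆ K` with `N * #K ≤ n` these probabilities
are exponentially small in `n` for a suitable `N` (`exists_sum_two_pow_mul_pow_le`), and the
Borel–Cantelli lemma applies (`exists_ae_eventually_err_le`).
-/

namespace WNN

/-! ### Cells of a piecewise continuous labeling -/

section Cells

variable {X : Type*} [MetricSpace X]

/-- A cell for `l`: a set in which any two points are closer to each other than the first is to any
point with a different label. In particular `l` is constant on a cell. -/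
def IsCell (l : X → ℤ) (U : Set X) : Prop :=
  ∀ a ∈ U, ∀ b ∈ U, ∀ c, l c ≠ l a → dist a b < dist a c

theorem IsCell.label_eq {l : X → ℤ} {U : Set X} (hU : IsCell l U) {a b : X} (ha : a ∈ U)
    (hb : b ∈ U) : l a = l b := by
  by_contra h
  exact lt_irrefl _ (hU a ha b hb b (Ne.symm h))

/-- Small balls around a point near which `l` is constant are cells. -/
theorem exists_isCell_of_continuousAt {l : X → ℤ} {u : X} (hu : ContinuousAt l u) :
    ∃ r > 0, IsCell l (Metric.ball u r) := by
  have h : ∀ᶠ y in 𝓝 u, l y = l u := hu (mem_nhds_discrete (s := {l u}).2 rfl)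
  obtain ⟨ρ, hρ, hball⟩ := Metric.eventually_nhds_iff.1 h
  refine ⟨ρ / 4, by positivity, fun a ha b hb c hc => ?_⟩
  rw [Metric.mem_ball] at ha hb
  have hla : l a = l u := hball (by linarith)
  have hcu : ρ ≤ dist c u := by
    by_contra! hlt
    exact hc ((hball hlt).trans hla.symm)
  have h1 : dist a b ≤ dist a u + dist b u := dist_triangle_right a b u
  have h2 : dist c u ≤ dist a c + dist a u := by
    rw [dist_comm a c]
    exact dist_triangle c a u
  linarith

variable [MeasurableSpace X]

theorem CountablyPiecewiseContinuous.ae_continuousAt {μ : Measure X} {l : X → ℤ}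
    (hl : CountablyPiecewiseContinuous μ l) : ∀ᵐ u ∂μ, ContinuousAt l u := by
  obtain ⟨A, hA, h⟩ := hl
  have hf : ∀ᵐ u ∂μ, ∀ i, u ∉ frontier (A i) :=
    ae_all_iff.2 fun i => measure_eq_zero_iff_ae_notMem.1 (h i).1
  filter_upwards [hf] with u hu
  obtain ⟨i, hi⟩ := Set.mem_iUnion.1 (hA.symm ▸ Set.mem_univ u)
  have hint : u ∈ interior (A i) := by
    by_contra hn
    exact hu i ⟨subset_closure hi, hn⟩
  exact (h i).2.continuousAt (isOpen_interior.mem_nhds hint)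

/-- Almost all of the space is covered by countably many open cells. -/
theorem exists_isCell_cover [SecondCountableTopology X] {μ : Measure X} {l : X → ℤ}
    (hl : CountablyPiecewiseContinuous μ l) :
    ∃ U : ℕ → Set X, (∀ i, IsOpen (U i)) ∧ (∀ i, IsCell l (U i)) ∧ μ (⋃ i, U i)ᶜ = 0 := by
  classical
  choose! r hr hcell using fun (u : X) (hu : ContinuousAt l u) => exists_isCell_of_continuousAt hu
  obtain ⟨t, hts, htc, hcov⟩ := TopologicalSpace.countable_cover_nhdsWithin
    (f := fun u => Metric.ball u (r u)) (s := {u | ContinuousAt l u})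
    fun u hu => mem_nhdsWithin_of_mem_nhds (Metric.ball_mem_nhds u (hr u hu))
  have hnull : μ {u | ContinuousAt l u}ᶜ = 0 := hl.ae_continuousAt
  rcases t.eq_empty_or_nonempty with rfl | hne
  · refine ⟨fun _ => ∅, fun _ => isOpen_empty, fun _ a ha => ha.elim, measure_mono_null ?_ hnull⟩
    simpa using hcov
  · obtain ⟨g, rfl⟩ := htc.exists_eq_range hne
    refine ⟨fun i => Metric.ball (g i) (r (g i)), fun _ => Metric.isOpen_ball,
      fun i => hcell _ (hts ⟨i, rfl⟩), measure_mono_null (Set.compl_subset_compl.2 ?_) hnull⟩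
    simpa using hcov

end Cells

/-! ### The classifier in terms of the tied indices -/

section Deterministic

variable {X : Type*} [MetricSpace X]

theorem enemyDist_pos (l : X → ℤ) {n : ℕ} (x : Fin n → X) (q : X) : 0 < enemyDist l x q := by
  unfold enemyDist
  split_ifs with h
  · rw [Finset.lt_inf'_iff]
    intro j hj
    refine dist_pos.2 fun hq => (Finset.mem_filter.1 hj).2 ?_
    rw [hq]
  · exact one_pos

theorem enemyDist_le (l : X → ℤ) {n : ℕ} (x : Fin n → X) {q : X} {j : Fin n}
    (hj : l (x j) ≠ l q) : enemyDist l x q ≤ dist q (x j) := by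
  classical
  have hmem : j ∈ Finset.univ.filter fun j => l (x j) ≠ l q := by simpa using hj
  unfold enemyDist
  rw [dif_pos ⟨j, by convert hmem⟩]
  exact Finset.inf'_le _ (by convert hmem)

theorem exists_enemyDist_eq (l : X → ℤ) {n : ℕ} (x : Fin n → X) {q : X} {j : Fin n}
    (hj : l (x j) ≠ l q) : ∃ k, l (x k) ≠ l q ∧ enemyDist l x q = dist q (x k) := by
  classical
  have h : (Finset.univ.filter fun j => l (x j) ≠ l q).Nonempty := ⟨j, by simpa using hj⟩
  obtain ⟨k, hk, hmin⟩ := Finset.exists_mem_eq_inf' h fun j => dist q (x j)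
  refine ⟨k, (Finset.mem_filter.1 hk).2, ?_⟩
  unfold enemyDist
  rw [dif_pos (by convert h)]
  convert hmin

theorem enemyWeight_pos (l : X → ℤ) {n : ℕ} (x : Fin n → X) (I : Finset (Fin n)) (q : X) :
    0 < enemyWeight l x I q := by
  unfold enemyWeight
  split_ifs
  · exact enemyDist_pos l x q
  · exact one_pos

theorem enemyWeight_of_mem (l : X → ℤ) {n : ℕ} (x : Fin n → X) {I : Finset (Fin n)} {i : Fin n}
    (hi : i ∈ I) : enemyWeight l x I (x i) = enemyDist l x (x i) :=
  if_pos ⟨i, hi, rfl⟩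

open scoped Classical in
/-- The indices in `I` minimizing `dist (x i) q / v i`, for weights `v` attached to the indices. -/
noncomputable def tied {n : ℕ} (v : Fin n → ℝ) (x : Fin n → X) (I : Finset (Fin n)) (q : X) :
    Finset (Fin n) :=
  I.filter fun i => ∀ j ∈ I, dist (x i) q / v i ≤ dist (x j) q / v j

/-- The weight of the query point scales all weighted distances alike, so it does not influence
which sample points are nearest. -/
theorem nearest_eq_tied (l : X → ℤ) {n : ℕ} (x : Fin n → X) (I : Finset (Fin n)) (q : X)
    {v : Fin n → ℝ} (hv : ∀ i ∈ I, enemyDist l x (x i) = v i) :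
    nearest (enemyWeight l x I) x I q = tied v x I q := by
  refine Finset.filter_congr fun i hi => forall₂_congr fun j hj => ?_
  have hq := enemyWeight_pos l x I q
  unfold weightedDist
  rw [enemyWeight_of_mem l x hi, enemyWeight_of_mem l x hj, hv i hi, hv j hj, ← div_div, ← div_div]
  exact div_le_div_iff_of_pos_right hq

theorem tied_nonempty {n : ℕ} (v : Fin n → ℝ) (x : Fin n → X) {I : Finset (Fin n)}
    (hI : I.Nonempty) (q : X) : (tied v x I q).Nonempty := by
  obtain ⟨i, hi, hmin⟩ := I.exists_min_image (fun i => dist (x i) q / v i) hI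
  exact ⟨i, Finset.mem_filter.2 ⟨hi, hmin⟩⟩

variable [MeasurableSpace X]

/-- The label that the tie-breaking rule assigns to `q` when `T` is the set of tied indices; on the
empty set it is `0`, as for `classifier`. -/
noncomputable def tieLabel (τ : TieBreak X) (l : X → ℤ) {n : ℕ} (x : Fin n → X) (q : X)
    (T : Finset (Fin n)) : ℤ :=
  if h : T.Nonempty then l (x (τ.pick T h (fun i => x i) q)) else 0

theorem enemyClassifier_eq_tieLabel (τ : TieBreak X) (l : X → ℤ) {n : ℕ} (x : Fin n → X)
    (I : Finset (Fin n)) (q : X) {v : Fin n → ℝ} (hv : ∀ i ∈ I, enemyDist l x (x i) = v i) :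
    enemyClassifier τ l x I q = tieLabel τ l x q (tied v x I q) := by
  rw [← nearest_eq_tied l x I q hv]
  rfl

/-! ### Small consistent subsamples -/

/-- A subsample is consistent as soon as every sample point is closer to some subsample point `y`
of its own label than `y` is to its nearest enemy: the weighted distance to `y` is then less
than `1`, while the weighted distance between enemies is at least `1`. -/
theorem isConsistent_of_cover (τ : TieBreak X) (l : X → ℤ) {n : ℕ} (x : Fin n → X)
    (J : Finset (Fin n))
    (hJ : ∀ j, ∃ y ∈ J, l (x y) = l (x j) ∧
      ∀ k, l (x k) ≠ l (x y) → dist (x y) (x j) < dist (x y) (x k)) :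
    IsConsistent τ l x J := by
  intro j
  obtain ⟨y, hyJ, hyl, hy⟩ := hJ j
  set v : Fin n → ℝ := fun i => enemyDist l x (x i)
  rw [enemyClassifier_eq_tieLabel τ l x J (x j) (v := v) fun _ _ => rfl]
  have hT := tied_nonempty v x ⟨y, hyJ⟩ (x j)
  rw [tieLabel, dif_pos hT]
  obtain ⟨i, hi⟩ := τ.pick _ hT (fun i => x i) (x j)
  change l (x i) = l (x j)
  by_contra hne
  have hle := (Finset.mem_filter.1 hi).2 y hyJ
  have hi1 : 1 ≤ dist (x i) (x j) / v i :=
    (one_le_div (enemyDist_pos l x (x i))).2 (enemyDist_le l x (Ne.symm hne))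
  have hy1 : dist (x y) (x j) / v y < 1 := by
    rw [div_lt_one (enemyDist_pos l x (x y))]
    -- The enemy `x i` exists, so `enemyDist l x (x y)` is a distance and not the default value `1`.
    obtain ⟨k, hk, hkd⟩ := exists_enemyDist_eq l x (q := x y) (j := i) (hyl ▸ hne)
    change dist (x y) (x j) < enemyDist l x (x y)
    rw [hkd]
    exact hy k hk
  linarith

open scoped Classical in
/-- One representative from each of `m` cells, together with all sample points outside the cells,
form a consistent subsample. -/
theorem exists_isConsistent_card_le (τ : TieBreak X) (l : X → ℤ) {m : ℕ} (U : ℕ → Set X)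
    (hU : ∀ i, IsCell l (U i)) {n : ℕ} (x : Fin n → X) :
    ∃ J : Finset (Fin n), IsConsistent τ l x J ∧
      J.card ≤ m + (Finset.univ.filter fun j => x j ∉ ⋃ i < m, U i).card := by
  set R : Finset (Fin n) := Finset.univ.filter fun j => x j ∉ ⋃ i < m, U i
  set rep : ℕ → Finset (Fin n) := fun i =>
    if h : ∃ j, x j ∈ U i then {h.choose} else ∅
  refine ⟨(Finset.range m).biUnion rep ∪ R, isConsistent_of_cover τ l x _ fun j => ?_, ?_⟩
  · by_cases hj : j ∈ R
    · refine ⟨j, Finset.mem_union_right _ hj, rfl, fun k hk => ?_⟩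
      rw [dist_self]
      exact dist_pos.2 fun h => hk (by rw [h])
    · obtain ⟨i, hi, hji⟩ : ∃ i < m, x j ∈ U i := by
        simpa [R] using hj
      have hex : ∃ j, x j ∈ U i := ⟨j, hji⟩
      refine ⟨hex.choose, Finset.mem_union_left _ (Finset.mem_biUnion.2
        ⟨i, Finset.mem_range.2 hi, ?_⟩), (hU i).label_eq hex.choose_spec hji,
        fun k hk => hU i _ hex.choose_spec _ hji _ hk⟩
      simp only [rep]
      rw [dif_pos hex]
      exact Finset.mem_singleton_self _
  · refine (Finset.card_union_le _ _).trans (Nat.add_le_add_right ?_ _)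
    refine (Finset.card_biUnion_le_card_mul _ _ 1 fun i _ => ?_).trans (by simp)
    simp only [rep]
    split_ifs <;> simp

end Deterministic

/-! ### Compression: weights determined by few sample points -/

section Compression

variable {X : Type*} [MetricSpace X]

/-- The distance from `x i` to the closest of the sample points with index in `T`, or `1` if `T` is
empty. -/
noncomputable def minDist {n : ℕ} (x : Fin n → X) (i : Fin n) (T : Finset (Fin n)) : ℝ :=
  if h : T.Nonempty then T.inf' h fun j => dist (x i) (x j) else 1

open scoped Classical in
/-- The nearest-enemy distance of `x i` within the part of the sample indexed by `K`. -/
noncomputable def localEnemyDist (l : X → ℤ) {n : ℕ} (K : Finset (Fin n)) (x : Fin n → X)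
    (i : Fin n) : ℝ :=
  minDist x i (K.filter fun j => l (x j) ≠ l (x i))

theorem enemyDist_eq_localEnemyDist_of_mem (l : X → ℤ) {n : ℕ} (x : Fin n → X)
    {K : Finset (Fin n)} {i k : Fin n} (hk : k ∈ K) (hne : l (x k) ≠ l (x i))
    (hd : enemyDist l x (x i) = dist (x i) (x k)) :
    enemyDist l x (x i) = localEnemyDist l K x i := by
  classical
  have hmem : k ∈ K.filter fun j => l (x j) ≠ l (x i) := Finset.mem_filter.2 ⟨hk, hne⟩
  unfold localEnemyDist minDist
  rw [dif_pos ⟨k, by convert hmem⟩]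
  refine le_antisymm (Finset.le_inf' _ _ fun j hj => ?_) ?_
  · exact enemyDist_le l x (Finset.mem_filter.1 hj).2
  · rw [hd]
    exact Finset.inf'_le _ (by convert hmem)

theorem enemyDist_eq_localEnemyDist_of_forall_eq (l : X → ℤ) {n : ℕ} (x : Fin n → X)
    (K : Finset (Fin n)) {i : Fin n} (h : ∀ k, l (x k) = l (x i)) :
    enemyDist l x (x i) = localEnemyDist l K x i := by
  simp [enemyDist, localEnemyDist, minDist, h]

/-- Adjoining to a subsample one nearest enemy for each of its points at most doubles its size, and
yields a set of sample points that determines all the weights. -/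
theorem exists_superset_enemyDist_eq (l : X → ℤ) {n : ℕ} (x : Fin n → X) (I : Finset (Fin n)) :
    ∃ K : Finset (Fin n), I ⊆ K ∧ K.card ≤ 2 * I.card ∧
      ∀ i ∈ I, enemyDist l x (x i) = localEnemyDist l K x i := by
  classical
  have h : ∀ i, ∃ k, (∃ j, l (x j) ≠ l (x i)) →
      l (x k) ≠ l (x i) ∧ enemyDist l x (x i) = dist (x i) (x k) := fun i => by
    by_cases hi : ∃ j, l (x j) ≠ l (x i)
    · obtain ⟨j, hj⟩ := hi
      obtain ⟨k, hk⟩ := exists_enemyDist_eq l x hj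
      exact ⟨k, fun _ => hk⟩
    · exact ⟨i, fun h => (hi h).elim⟩
  choose e he using h
  refine ⟨I ∪ I.image e, Finset.subset_union_left, ?_, fun i hi => ?_⟩
  · have h1 := Finset.card_union_le I (I.image e)
    have h2 : (I.image e).card ≤ I.card := Finset.card_image_le
    omega
  · by_cases hex : ∃ j, l (x j) ≠ l (x i)
    · exact enemyDist_eq_localEnemyDist_of_mem l x
        (Finset.mem_union_right _ (Finset.mem_image_of_mem e hi)) (he i hex).1 (he i hex).2
    · push Not at hex
      exact enemyDist_eq_localEnemyDist_of_forall_eq l x _ hex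

/-- `localEnemyDist l K x i` depends on `x` only through its restriction to `K`, if `i ∈ K`. -/
theorem localEnemyDist_congr (l : X → ℤ) {n : ℕ} {K : Finset (Fin n)} {x x' : Fin n → X}
    (hx : ∀ i ∈ K, x i = x' i) {i : Fin n} (hi : i ∈ K) :
    localEnemyDist l K x i = localEnemyDist l K x' i := by
  classical
  have hT : (K.filter fun j => l (x j) ≠ l (x i)) = K.filter fun j => l (x' j) ≠ l (x' i) :=
    Finset.filter_congr fun j hj => by rw [hx j hj, hx i hi]
  have hmin : ∀ T ⊆ K, minDist x i T = minDist x' i T := fun T hT => by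
    unfold minDist
    split_ifs with h
    · exact Finset.inf'_congr h rfl fun j hj => by rw [hx i hi, hx j (hT hj)]
    · rfl
  unfold localEnemyDist
  rw [hmin _ (Finset.filter_subset _ _)]
  congr 1

variable [MeasurableSpace X]

/-- The weighted nearest neighbor classifier of the subsample `I`, with the nearest-enemy weights
computed within the part of the sample indexed by `K`. -/
noncomputable def localClassifier (τ : TieBreak X) (l : X → ℤ) {n : ℕ} (I K : Finset (Fin n))
    (x : Fin n → X) (q : X) : ℤ :=
  tieLabel τ l x q (tied (localEnemyDist l K x) x I q)

theorem localClassifier_congr (τ : TieBreak X) (l : X → ℤ) {n : ℕ} {I K : Finset (Fin n)}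
    (hIK : I ⊆ K) {x x' : Fin n → X} (hx : ∀ i ∈ K, x i = x' i) :
    localClassifier τ l I K x = localClassifier τ l I K x' := by
  classical
  ext q
  have hT : tied (localEnemyDist l K x) x I q = tied (localEnemyDist l K x') x' I q :=
    Finset.filter_congr fun i hi => forall₂_congr fun j hj => by
      rw [localEnemyDist_congr l hx (hIK hi), localEnemyDist_congr l hx (hIK hj),
        hx i (hIK hi), hx j (hIK hj)]
  have hlabel : ∀ T ⊆ K, tieLabel τ l x q T = tieLabel τ l x' q T := fun T hT => by
    unfold tieLabel
    split_ifs with h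
    · have hres : (fun i : T => x i) = fun i : T => x' i := funext fun i => hx i (hT i.2)
      rw [hres, hx _ (hT (τ.pick T h (fun i => x' i) q).2)]
    · rfl
  unfold localClassifier
  rw [hT]
  exact hlabel _ ((Finset.filter_subset _ _).trans hIK)

theorem exists_enemyClassifier_eq_localClassifier (τ : TieBreak X) (l : X → ℤ) {n : ℕ}
    (x : Fin n → X) (I : Finset (Fin n)) :
    ∃ K : Finset (Fin n), I ⊆ K ∧ K.card ≤ 2 * I.card ∧
      enemyClassifier τ l x I = localClassifier τ l I K x := by
  obtain ⟨K, hIK, hcard, hK⟩ := exists_superset_enemyDist_eq l x I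
  exact ⟨K, hIK, hcard, funext fun q => enemyClassifier_eq_tieLabel τ l x I q hK⟩

end Compression

/-! ### Measurability of the classifier -/

section Measurability

/-- A function that depends measurably on a point and on a finite set of indices cut out by
measurable conditions on the point is measurable. -/
theorem measurable_apply_filter {Y Z ι : Type*} [MeasurableSpace Y] [MeasurableSpace Z] [Fintype ι]
    (K : Finset ι) {p : Y → ι → Prop} [∀ y, DecidablePred (p y)]
    (hp : ∀ i, MeasurableSet {y | p y i})
    {g : Finset ι → Y → Z} (hg : ∀ T, Measurable (g T)) :
    Measurable fun y => g (K.filter (p y)) y := by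
  classical
  have hT : ∀ T : Finset ι, MeasurableSet {y | K.filter (p y) = T} := fun T => by
    have : {y | K.filter (p y) = T} = ⋂ i, {y | (i ∈ K ∧ p y i) ↔ i ∈ T} := by
      ext y
      simp [Finset.ext_iff]
    rw [this]
    exact MeasurableSet.iInter fun i =>
      (((MeasurableSet.const _).inter (hp i)).iff (MeasurableSet.const _))
  intro s hs
  have : (fun y => g (K.filter (p y)) y) ⁻¹' s =
      ⋃ T : Finset ι, {y | K.filter (p y) = T} ∩ g T ⁻¹' s := by
    ext y
    simp
  rw [this]
  exact MeasurableSet.iUnion fun T => (hT T).inter (hg T hs)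

theorem measurable_tieLabel {X : Type*} [MeasurableSpace X] (τ : TieBreak X) {l : X → ℤ}
    (hl : Measurable l) {n : ℕ} (T : Finset (Fin n)) :
    Measurable fun p : (Fin n → X) × X => tieLabel τ l p.1 p.2 T := by
  unfold tieLabel
  split_ifs with h
  · have hpick : Measurable fun p : (Fin n → X) × X => τ.pick T h (fun i => p.1 i) p.2 :=
      (τ.measurable_pick T h).comp (f := fun p : (Fin n → X) × X => (fun i : T => p.1 i, p.2))
        (by fun_prop)
    have heval : Measurable fun r : T × ((Fin n → X) × X) => l (r.2.1 r.1) :=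
      measurable_from_prod_countable_right fun k => 
        hl.comp ((measurable_pi_apply (k : Fin n)).comp measurable_fst)
    exact heval.comp (hpick.prodMk measurable_id)
  · exact measurable_const

variable {X : Type*} [MetricSpace X] [SecondCountableTopology X] [MeasurableSpace X] [BorelSpace X]

theorem measurable_minDist {n : ℕ} (i : Fin n) (T : Finset (Fin n)) :
    Measurable fun x : Fin n → X => minDist x i T := by
  unfold minDist
  split_ifs with h
  · have hinf := Finset.inf'_induction h (fun j (x : Fin n → X) => dist (x i) (x j))
      (p := Measurable) (fun _ ha _ hb => ha.inf hb)
      fun j _ => (measurable_pi_apply i).dist (measurable_pi_apply j)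
    convert hinf using 1
    ext x
    simp [Finset.inf'_apply]
  · exact measurable_const

theorem measurable_localEnemyDist {l : X → ℤ} (hl : Measurable l) {n : ℕ} (K : Finset (Fin n))
    (i : Fin n) : Measurable fun x : Fin n → X => localEnemyDist l K x i := by
  refine measurable_apply_filter K (p := fun (x : Fin n → X) j => l (x j) ≠ l (x i))
    (g := fun T x => minDist x i T) (fun j => ?_) fun T => measurable_minDist i T
  exact (measurableSet_eq_fun (hl.comp (measurable_pi_apply j))
    (hl.comp (measurable_pi_apply i))).compl

theorem measurable_localClassifier (τ : TieBreak X) {l : X → ℤ} (hl : Measurable l) {n : ℕ}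
    (I K : Finset (Fin n)) :
    Measurable fun p : (Fin n → X) × X => localClassifier τ l I K p.1 p.2 := by
  classical
  have hw : ∀ i, Measurable fun p : (Fin n → X) × X =>
      dist (p.1 i) p.2 / localEnemyDist l K p.1 i := fun i =>
    (((measurable_pi_apply i).comp measurable_fst).dist measurable_snd).div
      ((measurable_localEnemyDist hl K i).comp measurable_fst)
  refine measurable_apply_filter I
    (p := fun (p : (Fin n → X) × X) i => ∀ j ∈ I,
      dist (p.1 i) p.2 / localEnemyDist l K p.1 i ≤ dist (p.1 j) p.2 / localEnemyDist l K p.1 j)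
    (g := fun T (p : (Fin n → X) × X) => tieLabel τ l p.1 p.2 T)
    (fun i => ?_) (measurable_tieLabel τ hl)
  simp only [Set.ofPred_forall]
  exact MeasurableSet.iInter fun j => MeasurableSet.iInter fun _ => measurableSet_le (hw i) (hw j)

end Measurability

/-! ### The generalization bound -/

section Generalization

/-- For `s < 1`, the subsets `K` of an `n`-element set with `N * #K ≤ n`, each weighted by
`2 ^ #K * s ^ (n - #K)`, have exponentially small total weight, provided `N` is large. -/
theorem exists_sum_two_pow_mul_pow_le {s : ℝ} (hs0 : 0 ≤ s) (hs1 : s < 1) :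
    ∃ N : ℕ, 0 < N ∧ ∃ ρ : ℝ, 0 ≤ ρ ∧ ρ < 1 ∧ ∀ n : ℕ,
      ∑ K : Finset (Fin n) with N * K.card ≤ n, 2 ^ K.card * s ^ (n - K.card) ≤ ρ ^ n := by
  -- With `t + s < 1` the binomial theorem bounds the sum of `t ^ #K * s ^ (n - #K)` by
  -- `(t + s) ^ n = ρ ^ (2 * n)`. The factors `(2 / t) ^ #K` cost no more than `ρ ^ (-n)`.
  set t : ℝ := (1 - s) / 2 with ht
  have ht0 : 0 < t := by linarith
  set ρ : ℝ := √(t + s) with hρ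
  have hρ0 : 0 < ρ := Real.sqrt_pos.2 (by linarith)
  have hρsq : ρ * ρ = t + s := Real.mul_self_sqrt (by linarith)
  have hρ1 : ρ < 1 := by
    rw [hρ, Real.sqrt_lt' one_pos]
    linarith
  obtain ⟨M, hM⟩ := exists_pow_lt_of_lt_one (show 0 < t / 2 by positivity) hρ1
  have hN : 2 / t * ρ ^ (M + 1) ≤ 1 := by
    have h1 : ρ ^ (M + 1) ≤ t / 2 :=
      (pow_le_pow_of_le_one hρ0.le hρ1.le (Nat.le_succ M)).trans hM.le
    calc 2 / t * ρ ^ (M + 1) ≤ 2 / t * (t / 2) := by gcongr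
      _ = 1 := by field_simp
  refine ⟨M + 1, M.succ_pos, ρ, hρ0.le, hρ1, fun n => ?_⟩
  have hterm : ∀ K : Finset (Fin n), (M + 1) * K.card ≤ n →
      ρ ^ n * (2 ^ K.card * s ^ (n - K.card)) ≤ t ^ K.card * s ^ (n - K.card) := fun K hK => by
    have h1 : ρ ^ n ≤ (ρ ^ (M + 1)) ^ K.card := by
      rw [← pow_mul]
      exact pow_le_pow_of_le_one hρ0.le hρ1.le hK
    have h2 : ρ ^ n * 2 ^ K.card ≤ t ^ K.card := by
      calc ρ ^ n * 2 ^ K.card ≤ (ρ ^ (M + 1)) ^ K.card * 2 ^ K.card := by gcongr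
        _ = (2 / t * ρ ^ (M + 1)) ^ K.card * t ^ K.card := by
          rw [← mul_pow, ← mul_pow]
          congr 1
          field_simp
        _ ≤ 1 * t ^ K.card := by
          gcongr
          exact pow_le_one₀ (by positivity) hN
        _ = t ^ K.card := one_mul _
    calc ρ ^ n * (2 ^ K.card * s ^ (n - K.card)) = (ρ ^ n * 2 ^ K.card) * s ^ (n - K.card) := by
          ring
      _ ≤ _ := by gcongr
  have hbinom : ∑ K : Finset (Fin n), t ^ K.card * s ^ (n - K.card) = ρ ^ n * ρ ^ n := by
    rw [← mul_pow, hρsq]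
    simpa using Fintype.sum_pow_mul_eq_add_pow (Fin n) t s
  refine le_of_mul_le_mul_left ?_ (pow_pos hρ0 n)
  rw [← hbinom, Finset.mul_sum]
  refine (Finset.sum_le_sum fun K hK => hterm K (Finset.mem_filter.1 hK).2).trans ?_
  exact Finset.sum_le_sum_of_subset_of_nonneg (Finset.filter_subset _ _) fun K _ _ => by positivity

variable {X : Type*} [MeasurableSpace X] {μ : Measure X} [IsProbabilityMeasure μ] {l : X → ℤ}

/-- Let the classifier `H x` depend only on the sample points with index in `K`. The other sample
points are independent of it, so the probability that `H x` labels all of them correctly although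
its error exceeds `ε` is at most `(1 - ε) ^ (n - #K)`. -/
theorem pi_err_gt_and_correct_le (hl : Measurable l) {n : ℕ} (K : Finset (Fin n))
    {H : (Fin n → X) → X → ℤ} (hH : Measurable fun p : (Fin n → X) × X => H p.1 p.2)
    (hdep : ∀ x x' : Fin n → X, (∀ i ∈ K, x i = x' i) → H x = H x') (ε : ENNReal) :
    Measure.pi (fun _ : Fin n => μ) {x | ε < err μ l (H x) ∧ ∀ j ∉ K, H x (x j) = l (x j)} ≤
      (1 - ε) ^ (n - K.card) := by
  set E : Set (Fin n → X) := {x | ε < err μ l (H x) ∧ ∀ j ∉ K, H x (x j) = l (x j)}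
  have hE : MeasurableSet E := by
    refine MeasurableSet.inter (s₁ := {x | ε < err μ l (H x)})
      (s₂ := {x | ∀ j ∉ K, H x (x j) = l (x j)}) ?_ ?_
    · refine measurableSet_lt measurable_const (measurable_measure_prodMk_left
        (s := {p : (Fin n → X) × X | H p.1 p.2 ≠ l p.2}) ?_)
      exact (measurableSet_eq_fun hH (hl.comp measurable_snd)).compl
    · simp only [Set.ofPred_forall]
      refine MeasurableSet.iInter fun j => MeasurableSet.iInter fun _ => measurableSet_eq_fun ?_
        (hl.comp (measurable_pi_apply j))
      exact hH.comp (measurable_id.prodMk (measurable_pi_apply j))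
  set e := MeasurableEquiv.piEquivPiSubtypeProd (fun _ : Fin n => X) (· ∈ K)
  have hmp := (measurePreserving_piEquivPiSubtypeProd (fun _ : Fin n => μ) (· ∈ K)).symm e
  rw [← hmp.measure_preimage hE.nullMeasurableSet,
    Measure.prod_apply (hmp.measurable hE)]
  have hfiber : ∀ a : {i // i ∈ K} → X, Measure.pi (fun _ : {i // i ∉ K} => μ)
      (Prod.mk a ⁻¹' (e.symm ⁻¹' E)) ≤ (1 - ε) ^ (n - K.card) := fun a => by
    rcases (Prod.mk a ⁻¹' (e.symm ⁻¹' E)).eq_empty_or_nonempty with h0 | ⟨b₀, hb₀⟩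
    · simp [h0]
    set x₀ := e.symm (a, b₀)
    have hx₀ : x₀ ∈ E := hb₀
    -- By `hdep` the classifier is the same on the whole fiber over `a`, so each of the remaining
    -- coordinates has to lie in the set where `H x₀` is correct.
    have hsub : Prod.mk a ⁻¹' (e.symm ⁻¹' E) ⊆ Set.univ.pi fun _ => {q | H x₀ q = l q} := by
      intro b hb j _
      have hbE : e.symm (a, b) ∈ E := hb
      have hj := hbE.2 j j.2
      have hHb : H (e.symm (a, b)) = H x₀ := hdep _ _ fun i hi => by
        simp [x₀, e, MeasurableEquiv.piEquivPiSubtypeProd_symm_apply, hi]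
      have hbj : e.symm (a, b) j = b j := by
        simp [e, MeasurableEquiv.piEquivPiSubtypeProd_symm_apply, j.2]
      rw [hHb, hbj] at hj
      exact hj
    have hgood : MeasurableSet {q | H x₀ q = l q} :=
      measurableSet_eq_fun (hH.comp measurable_prodMk_left) hl
    have hμ : μ {q | H x₀ q = l q} ≤ 1 - ε := by
      have hc : μ {q | H x₀ q = l q}ᶜ = err μ l (H x₀) := rfl
      rw [← compl_compl {q | H x₀ q = l q}, prob_compl_eq_one_sub hgood.compl, hc]
      exact tsub_le_tsub_left hx₀.1.le 1
    refine (measure_mono hsub).trans ?_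
    rw [Measure.pi_pi, Finset.prod_const, Finset.card_univ, Fintype.card_subtype_compl,
      Fintype.card_fin, Fintype.card_coe]
    gcongr
  refine (lintegral_mono hfiber).trans ?_
  simp

end Generalization

/-! ### Almost sure statements about the sample -/

section Sample

variable {X : Type*} [MeasurableSpace X] {μ : Measure X}
  {Ω : Type*} [MeasurableSpace Ω] {P : Measure Ω} [IsProbabilityMeasure P] {ξ : ℕ → Ω → X}

theorem map_sample_eq_pi (hξ_meas : ∀ i, Measurable (ξ i)) (hξ_law : ∀ i, P.map (ξ i) = μ)
    (hξ_indep : iIndepFun ξ P) (n : ℕ) :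
    P.map (fun ω (i : Fin n) => ξ i ω) = Measure.pi fun _ : Fin n => μ := by
  have h := (iIndepFun_iff_map_fun_eq_pi_map fun i : Fin n => (hξ_meas i).aemeasurable).1
    (hξ_indep.precomp Fin.val_injective)
  rw [h]
  simp only [hξ_law]

open scoped Classical in
/-- The strong law of large numbers for the number of visits to a set. -/
theorem ae_tendsto_card_filter_mem_div (hξ_meas : ∀ i, Measurable (ξ i))
    (hξ_law : ∀ i, P.map (ξ i) = μ) (hξ_indep : iIndepFun ξ P) {V : Set X}
    (hV : MeasurableSet V) :
    ∀ᵐ ω ∂P, Tendsto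
      (fun n : ℕ => ((Finset.univ.filter fun i : Fin n => ξ i ω ∈ V).card : ℝ) / n)
      atTop (𝓝 (μ.real V)) := by
  set g : X → ℝ := V.indicator fun _ => 1
  have hg : Measurable g := measurable_const.indicator hV
  have hident : ∀ i, IdentDistrib (ξ i) (ξ 0) P P := fun i =>
    ⟨(hξ_meas i).aemeasurable, (hξ_meas 0).aemeasurable, (hξ_law i).trans (hξ_law 0).symm⟩
  have hmean : ∫ ω, g (ξ 0 ω) ∂P = μ.real V := by
    rw [← integral_map (hξ_meas 0).aemeasurable hg.aestronglyMeasurable, hξ_law 0]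
    exact integral_indicator_one hV
  have hint : Integrable (fun ω => g (ξ 0 ω)) P := by
    refine Integrable.of_bound (hg.comp (hξ_meas 0)).aestronglyMeasurable 1 (ae_of_all _ fun ω => ?_)
    by_cases h : ξ 0 ω ∈ V <;> simp [g, h]
  have hlln := strong_law_ae_real (μ := P) (fun i ω => g (ξ i ω)) hint
    (fun i j hij => (hξ_indep.indepFun hij).comp hg hg) fun i => (hident i).comp hg
  filter_upwards [hlln] with ω hω
  rw [hmean] at hω
  refine hω.congr fun n => ?_
  rw [Finset.sum_range, Finset.card_filter]
  push_cast
  simp [g, Set.indicator_apply]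

variable [MetricSpace X] [SecondCountableTopology X] [BorelSpace X] [IsProbabilityMeasure μ]
  {l : X → ℤ}

/-- Almost surely, for all large `n`, every classifier built from at most `n / N` sample points
that labels the remaining sample points correctly has error at most `δ`. -/
theorem exists_ae_eventually_err_le (τ : TieBreak X) (hl : Measurable l)
    (hξ_meas : ∀ i, Measurable (ξ i)) (hξ_law : ∀ i, P.map (ξ i) = μ) (hξ_indep : iIndepFun ξ P)
    {δ : ℝ} (hδ0 : 0 < δ) (hδ1 : δ ≤ 1) :
    ∃ N : ℕ, 0 < N ∧ ∀ᵐ ω ∂P, ∀ᶠ n : ℕ in atTop, ∀ I K : Finset (Fin n), I ⊆ K → N * K.card ≤ n →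
      (∀ j ∉ K, localClassifier τ l I K (fun i : Fin n => ξ i ω) (ξ j ω) = l (ξ j ω)) →
      err μ l (localClassifier τ l I K fun i : Fin n => ξ i ω) ≤ ENNReal.ofReal δ := by
  obtain ⟨N, hN, ρ, hρ0, hρ1, hsum⟩ :=
    exists_sum_two_pow_mul_pow_le (s := 1 - δ) (by linarith) (by linarith)
  refine ⟨N, hN, ?_⟩
  set E : (n : ℕ) → Finset (Fin n) → Finset (Fin n) → Set (Fin n → X) := fun n I K =>
    {x | ENNReal.ofReal δ < err μ l (localClassifier τ l I K x) ∧
      ∀ j ∉ K, localClassifier τ l I K x (x j) = l (x j)}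
  set B : ℕ → Set Ω := fun n =>
    ⋃ K ∈ Finset.univ.filter fun K : Finset (Fin n) => N * K.card ≤ n, ⋃ I ∈ K.powerset,
      {ω | (fun i : Fin n => ξ i ω) ∈ E n I K}
  have hE : ∀ (n : ℕ) (I K : Finset (Fin n)), I ⊆ K →
      P {ω | (fun i : Fin n => ξ i ω) ∈ E n I K} ≤
        ENNReal.ofReal ((1 - δ) ^ (n - K.card)) := fun n I K hIK => by
    have hmeas : Measurable fun ω (i : Fin n) => ξ i ω := measurable_pi_lambda _ fun i => hξ_meas i
    refine (Measure.le_map_apply hmeas.aemeasurable (E n I K)).trans ?_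
    rw [map_sample_eq_pi hξ_meas hξ_law hξ_indep]
    refine (pi_err_gt_and_correct_le hl K (measurable_localClassifier τ hl I K)
      (fun x x' hx => localClassifier_congr τ l hIK hx) _).trans_eq ?_
    rw [ENNReal.ofReal_pow (by linarith), ENNReal.ofReal_sub _ hδ0.le, ENNReal.ofReal_one]
  have hB : ∀ n, P (B n) ≤ ENNReal.ofReal (ρ ^ n) := fun n => by
    have hs : 0 ≤ 1 - δ := by linarith
    refine (measure_biUnion_finset_le _ _).trans (le_trans ?_ (ENNReal.ofReal_le_ofReal (hsum n)))
    rw [ENNReal.ofReal_sum_of_nonneg fun K _ =>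
      mul_nonneg (pow_nonneg zero_le_two _) (pow_nonneg hs _)]
    refine Finset.sum_le_sum fun K _ => (measure_biUnion_finset_le _ _).trans ?_
    refine (Finset.sum_le_card_nsmul _ _ _ fun I hI => hE n I K (Finset.mem_powerset.1 hI)).trans ?_
    rw [Finset.card_powerset, nsmul_eq_mul, ENNReal.ofReal_mul (pow_nonneg zero_le_two _),
      ENNReal.ofReal_pow zero_le_two]
    simp
  have hBsum : ∑' n, P (B n) ≠ ⊤ := by
    refine ne_top_of_le_ne_top ?_ (ENNReal.tsum_le_tsum hB)
    exact (summable_geometric_of_lt_one hρ0 hρ1).tsum_ofReal_ne_top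
  filter_upwards [ae_eventually_notMem hBsum] with ω hω
  filter_upwards [hω] with n hn I K hIK hK hcorrect
  by_contra! herr
  refine hn (Set.mem_biUnion (x := K) (by simpa using hK)
    (Set.mem_biUnion (x := I) (by simpa using hIK) ⟨herr, hcorrect⟩))

/-- Almost surely the sample has consistent subsamples of size `o(n)`. -/
theorem ae_eventually_exists_isConsistent (τ : TieBreak X)
    (hl_pc : CountablyPiecewiseContinuous μ l) (hξ_meas : ∀ i, Measurable (ξ i))
    (hξ_law : ∀ i, P.map (ξ i) = μ) (hξ_indep : iIndepFun ξ P) {N : ℕ} (hN : 0 < N) :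
    ∀ᵐ ω ∂P, ∀ᶠ n : ℕ in atTop, ∃ J : Finset (Fin n),
      IsConsistent τ l (fun i : Fin n => ξ i ω) J ∧ N * J.card ≤ n := by
  classical
  obtain ⟨U, hUo, hUc, hU0⟩ := exists_isCell_cover hl_pc
  have hUm : ∀ m, MeasurableSet (⋃ i < m, U i)ᶜ := fun m =>
    (MeasurableSet.iUnion fun i => MeasurableSet.iUnion fun _ => (hUo i).measurableSet).compl
  have hlim : Tendsto (fun m : ℕ => μ.real (⋃ i < m, U i)ᶜ) atTop (𝓝 0) := by
    have h := tendsto_measure_iInter_atTop (μ := μ) (s := fun m : ℕ => (⋃ i < m, U i)ᶜ)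
      (fun m => (hUm m).nullMeasurableSet)
      (fun m m' hmm => Set.compl_subset_compl.2
        (Set.biUnion_mono (fun i hi => lt_of_lt_of_le hi hmm) fun _ _ => subset_rfl))
      ⟨0, measure_ne_top _ _⟩
    have h0 : μ (⋂ m : ℕ, (⋃ i < m, U i)ᶜ) = 0 := by
      refine measure_mono_null (fun q hq => ?_) hU0
      simp only [Set.mem_iInter, Set.mem_compl_iff, Set.mem_iUnion, not_exists] at hq ⊢
      exact fun i => hq (i + 1) i (Nat.lt_succ_self i)
    rw [h0] at h
    exact (ENNReal.tendsto_toReal ENNReal.zero_ne_top).comp h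
  have hNR : (0 : ℝ) < N := Nat.cast_pos.2 hN
  obtain ⟨m, hm⟩ := (hlim.eventually_lt_const (show (0 : ℝ) < 1 / (2 * N) by positivity)).exists
  filter_upwards [ae_tendsto_card_filter_mem_div hξ_meas hξ_law hξ_indep (hUm m)] with ω hω
  -- At most `n / (2 * N)` sample points lie outside the first `m` cells, and `2 * N * m ≤ n`.
  filter_upwards [hω.eventually_lt_const hm, eventually_ge_atTop (2 * N * m + 1)] with n hn hmn
  obtain ⟨J, hJ, hJcard⟩ :=
    exists_isConsistent_card_le τ l (m := m) U hUc (fun i : Fin n => ξ i ω)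
  refine ⟨J, hJ, ?_⟩
  set R : ℕ := (Finset.univ.filter fun i : Fin n => ξ i ω ∈ (⋃ i < m, U i)ᶜ).card
  have hJR : J.card ≤ m + R := hJcard
  have hn0 : (0 : ℝ) < n := Nat.cast_pos.2 (by omega)
  have hRn : 2 * N * R ≤ n := by
    rw [div_lt_div_iff₀ hn0 (by positivity)] at hn
    have hn' : (R : ℝ) * (2 * N) < 1 * n := lt_of_eq_of_lt (by congr!) hn
    have : (2 * N * R : ℝ) ≤ n := by linarith
    exact_mod_cast this
  calc N * J.card ≤ N * (m + R) := Nat.mul_le_mul_left N hJR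
    _ ≤ n := by nlinarith

end Sample

end WNN

theorem mainTheorem3 {X : Type*} [MetricSpace X] [TopologicalSpace.SeparableSpace X]
    [MeasurableSpace X] [BorelSpace X]
    (μ : Measure X) [IsProbabilityMeasure μ] [NullSingletonClass μ]
    (l : X → ℤ) (hl : ∀ x, l x = 1 ∨ l x = -1) (hl_meas : Measurable l)
    (hl_pc : WNN.CountablyPiecewiseContinuous μ l)
    (τ : WNN.TieBreak X)
    {Ω : Type*} [MeasurableSpace Ω] (P : Measure Ω) [IsProbabilityMeasure P]
    (ξ : ℕ → Ω → X) (hξ_meas : ∀ i, Measurable (ξ i))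
    (hξ_law : ∀ i, P.map (ξ i) = μ) (hξ_indep : iIndepFun ξ P) :
    ∀ᵐ ω ∂P, ∀ S : (n : ℕ) → Finset (Fin n),
      (∀ n, WNN.IsMinConsistent τ l (fun i : Fin n => ξ i ω) (S n)) →
      Tendsto
        (fun n => WNN.err μ l (WNN.enemyClassifier τ l (fun i : Fin n => ξ i ω) (S n)))
        atTop (𝓝 0) := by
  have : SecondCountableTopology X := UniformSpace.secondCountable_of_separable X
  have hδ : ∀ k : ℕ, ∀ᵐ ω ∂P, ∀ᶠ n : ℕ in atTop, ∀ I : Finset (Fin n),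
      WNN.IsMinConsistent τ l (fun i : Fin n => ξ i ω) I →
      WNN.err μ l (WNN.enemyClassifier τ l (fun i : Fin n => ξ i ω) I) ≤
        ENNReal.ofReal (1 / ((k : ℝ) + 1)) := fun k => by
    obtain ⟨N, hN, herr⟩ := WNN.exists_ae_eventually_err_le τ hl_meas hξ_meas hξ_law hξ_indep
      (δ := 1 / ((k : ℝ) + 1)) Nat.one_div_pos_of_nat
      (div_le_one_of_le₀ (le_add_of_nonneg_left k.cast_nonneg) (by positivity))
    filter_upwards [herr, WNN.ae_eventually_exists_isConsistent τ hl_pc hξ_meas hξ_law hξ_indep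
      (N := N * 2) (by positivity)] with ω hω₁ hω₂
    filter_upwards [hω₁, hω₂] with n hn₁ ⟨J, hJ, hJcard⟩ I hI
    obtain ⟨K, hIK, hKcard, hK⟩ :=
      WNN.exists_enemyClassifier_eq_localClassifier τ l (fun i : Fin n => ξ i ω) I
    have hcard : N * K.card ≤ n :=
      calc N * K.card ≤ N * (2 * J.card) :=
            Nat.mul_le_mul_left N (hKcard.trans (Nat.mul_le_mul_left 2 (hI.2 J hJ)))
        _ = N * 2 * J.card := (mul_assoc _ _ _).symm
        _ ≤ n := hJcard
    rw [hK]
    refine hn₁ I K hIK hcard fun j _ => ?_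
    rw [← hK]
    exact hI.1 j
  filter_upwards [ae_all_iff.2 hδ] with ω hω S hS
  rw [ENNReal.tendsto_atTop_zero]
  intro ε hε
  have hlim : Tendsto (fun k : ℕ => ENNReal.ofReal (1 / ((k : ℝ) + 1))) atTop (𝓝 0) := by
    simpa [Function.comp_def] using (ENNReal.continuous_ofReal.tendsto 0).comp
      (tendsto_one_div_add_atTop_nhds_zero_nat (𝕜 := ℝ))
  obtain ⟨k, hk⟩ := (hlim.eventually_lt_const hε).exists
  obtain ⟨n₀, hn₀⟩ := eventually_atTop.1 (hω k)
  exact ⟨n₀, fun n hn => (hn₀ n hn (S n) (hS n)).trans hk.le⟩
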